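/- Let $\varepsilon\ge 0$ and $\delta\in[0,1]$. A pair of density matrices $(\rho,\sigma)$ on a common finite-dimensional complex Hilbert space is called $(\varepsilon,\delta)$-DP if for every operator $\Lambda$ with $0\le\Lambda\le I$, $$\mathrm{Tr}[\Lambda\rho]\le e^{\varepsilon}\,\mathrm{Tr}[\Lambda\sigma]+\delta\quad\text{and}\quad \mathrm{Tr}[\Lambda\sigma]\le e^{\varepsilon}\,\mathrm{Tr}[\Lambda\rho]+\delta .$$ Let $\mathfrak D_{(\varepsilon,\delta)}$ be the collection of all such pairs, over all finite dimensions. For $\theta\in(0,1)$ put $\rho_\theta=\theta\rho+(1-\theta)\sigma$. The SLD Fisher information of this family at $\theta$ is $J_\theta(\rho,\sigma)=\mathrm{Tr}(L_\theta^2\rho_\theta)$, where $L_\theta$ is a Hermitian operator with $\frac12(L_\theta\rho_\theta+\rho_\theta L_\theta)=\frac{d\rho_\theta}{d\theta}=\rho-\sigma$. For every $(\rho,\sigma)\in\mathfrak D_{(\varepsilon,\delta)}$ and $\theta\in(0,1)$ such an $L_\theta$ exists and $J_\theta(\rho,\sigma)$ does not depend on its choice. Moreover, for every $\theta\in(0,1)$,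 $$\max_{(\rho,\sigma)\in\mathfrak D_{(\varepsilon,\delta)}}J_\theta(\rho,\sigma)=\frac{\delta}{\theta(1-\theta)}+\frac{(1-\delta)(1-e^{\varepsilon})^2}{e^{\varepsilon}+(1-e^{\varepsilon})^2\,\theta(1-\theta)} .$$ The maximum is attained, for all $\theta\in(0,1)$ simultaneously, by the pair in $\mathfrak D_{(\varepsilon,\delta)}$ given in an orthonormal basis $|00\rangle,|01\rangle,|10\rangle,|11\rangle$ of $\mathbb C^4$ by $$\rho_{(\varepsilon,\delta)}=\delta|00\rangle\langle00|+(1-\delta)\Big(\tfrac{e^\varepsilon}{1+e^\varepsilon}|01\rangle\langle01|+\tfrac{1}{1+e^\varepsilon}|10\rangle\langle10|\Big),$$ $$\sigma_{(\varepsilon,\delta)}=(1-\delta)\Big(\tfrac{1}{1+e^\varepsilon}|01\rangle\langle01|+\tfrac{e^\varepsilon}{1+e^\varepsilon}|10\rangle\langle10|\Big)+\delta|11\rangle\langle11| .$$ -/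

import Mathlib

open Matrix ComplexOrder

/-- `ρ` is a density matrix: positive semidefinite (hence Hermitian) with unit trace. -/
def IsDensityMatrix {ι : Type*} [Fintype ι] (ρ : Matrix ι ι ℂ) : Prop :=
  ρ.PosSemidef ∧ ρ.trace = 1

/-- `Λ` is a test (a POVM element): `0 ≤ Λ ≤ 1`. -/
def IsTest {ι : Type*} [Fintype ι] [DecidableEq ι] (Λ : Matrix ι ι ℂ) : Prop :=
  Λ.PosSemidef ∧ (1 - Λ).PosSemidef

/-- `(ρ, σ)` is an `(ε, δ)`-differentially private pair of quantum states. The traces involved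
are real, so taking real parts loses nothing. -/
def IsDPPair {ι : Type*} [Fintype ι] [DecidableEq ι] (ε δ : ℝ) (ρ σ : Matrix ι ι ℂ) : Prop :=
  IsDensityMatrix ρ ∧ IsDensityMatrix σ ∧
    ∀ Λ : Matrix ι ι ℂ, IsTest Λ →
      (Λ * ρ).trace.re ≤ Real.exp ε * (Λ * σ).trace.re + δ ∧
      (Λ * σ).trace.re ≤ Real.exp ε * (Λ * ρ).trace.re + δ

/-- The one-parameter family `ρ_θ = θ ρ + (1 - θ) σ`. -/
noncomputable def mixFamily {ι : Type*} (ρ σ : Matrix ι ι ℂ) (θ : ℝ) : Matrix ι ι ℂ :=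
  θ • ρ + (1 - θ) • σ

/-- `L` is a symmetric logarithmic derivative of the family `τ` at `θ`: it is Hermitian and
`(L τ_θ + τ_θ L) / 2` is the (entrywise) derivative of `τ` at `θ`. -/
def IsSLD {ι : Type*} [Fintype ι] (τ : ℝ → Matrix ι ι ℂ) (θ : ℝ) (L : Matrix ι ι ℂ) : Prop :=
  L.IsHermitian ∧
    ∀ i j, HasDerivAt (fun t : ℝ => τ t i j) (((1 / 2 : ℂ) • (L * τ θ + τ θ * L)) i j) θ

/-- `J` is the SLD Fisher information `Tr (L² τ_θ)` of the family `τ` at `θ`, for a symmetric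
logarithmic derivative `L`. -/
def HasSLDFisherInfo {ι : Type*} [Fintype ι] [DecidableEq ι] (τ : ℝ → Matrix ι ι ℂ) (θ J : ℝ) :
    Prop :=
  ∃ L : Matrix ι ι ℂ, IsSLD τ θ L ∧ (L ^ 2 * τ θ).trace = (J : ℂ)

/-- The first state of the weakest pair, diagonal in the basis `|00⟩, |01⟩, |10⟩, |11⟩`:
`δ |00⟩⟨00| + (1 - δ) (e^ε / (1 + e^ε) |01⟩⟨01| + 1 / (1 + e^ε) |10⟩⟨10|)`. -/
noncomputable def weakestRho (ε δ : ℝ) : Matrix (Fin 2 × Fin 2) (Fin 2 × Fin 2) ℂ :=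
  δ • Matrix.single (0, 0) (0, 0) 1 +
    (1 - δ) • ((Real.exp ε / (1 + Real.exp ε)) • Matrix.single (0, 1) (0, 1) 1 +
      (1 / (1 + Real.exp ε)) • Matrix.single (1, 0) (1, 0) 1)

/-- The second state of the weakest pair:
`(1 - δ) (1 / (1 + e^ε) |01⟩⟨01| + e^ε / (1 + e^ε) |10⟩⟨10|) + δ |11⟩⟨11|`. -/
noncomputable def weakestSigma (ε δ : ℝ) : Matrix (Fin 2 × Fin 2) (Fin 2 × Fin 2) ℂ :=
  (1 - δ) • ((1 / (1 + Real.exp ε)) • Matrix.single (0, 1) (0, 1) 1 +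
      (Real.exp ε / (1 + Real.exp ε)) • Matrix.single (1, 0) (1, 0) 1) +
    δ • Matrix.single (1, 1) (1, 1) 1

/-- `δ / (θ (1 - θ)) + (1 - δ) (1 - e^ε)² / (e^ε + (1 - e^ε)² θ (1 - θ))`. -/
noncomputable def maxFisher (ε δ θ : ℝ) : ℝ :=
  δ / (θ * (1 - θ)) +
    (1 - δ) * (1 - Real.exp ε) ^ 2 / (Real.exp ε + (1 - Real.exp ε) ^ 2 * (θ * (1 - θ)))

/-! The upper bound reduces to a classical one: in an eigenbasis of the SLD, the diagonal of the SLD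
equation involves only the diagonals `p`, `q` of the two states, so `J` is the Fisher information of
these distributions. Testing with diagonal projections bounds both of their hockey-stick excesses by
`δ` (`IsDPPair.sum_max_le`). With `E = e^ε` and `t = θp + (1-θ)q`, `fisher_term_le` bounds each
outcome's `(p-q)²/t`, up to a common factor, by a linear function of `p`, `q` plus multiples of the
excesses; summing gives `maxFisher`. Equality needs each outcome to have ratio exactly `E` or `1/E`,
or one of `p`, `q` zero, as in the weakest pair. -/

theorem isSLD_mixFamily_iff {ι : Type*} [Fintype ι] {ρ σ L : Matrix ι ι ℂ} {θ : ℝ} :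
    IsSLD (mixFamily ρ σ) θ L ↔ L.IsHermitian ∧
      L * mixFamily ρ σ θ + mixFamily ρ σ θ * L = (2 : ℂ) • (ρ - σ) := by
  have hd (i j : ι) : HasDerivAt (fun t : ℝ => mixFamily ρ σ t i j) ((ρ - σ) i j) θ := by
    have h1 : HasDerivAt (fun t : ℝ => t • ρ i j + (1 - t) • σ i j)
        ((1 : ℝ) • ρ i j + (-1 : ℝ) • σ i j) θ :=
      ((hasDerivAt_id θ).smul_const (ρ i j)).add
        (((hasDerivAt_id θ).const_sub 1).smul_const (σ i j))
    simpa [mixFamily, sub_eq_add_neg] using h1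
  unfold IsSLD
  refine and_congr_right fun _ => ⟨fun h => ?_, fun h i j => ?_⟩
  · have h2 : (1 / 2 : ℂ) • (L * mixFamily ρ σ θ + mixFamily ρ σ θ * L) = ρ - σ := by
      ext i j
      exact (h i j).unique (hd i j)
    rw [← h2, smul_smul]
    norm_num
  · rw [h, smul_smul]
    simpa using hd i j

/-! ### Unitary change of basis -/

theorem IsDensityMatrix.conj {ι : Type*} [Fintype ι] [DecidableEq ι] {ρ U : Matrix ι ι ℂ}
    (h : IsDensityMatrix ρ) (hU : U * Uᴴ = 1) : IsDensityMatrix (Uᴴ * ρ * U) :=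
  ⟨h.1.conjTranspose_mul_mul_same U, by
    rw [Matrix.trace_mul_cycle, hU, one_mul, h.2]⟩

theorem IsTest.conj {ι : Type*} [Fintype ι] [DecidableEq ι] {Λ U : Matrix ι ι ℂ}
    (h : IsTest Λ) (hU : U * Uᴴ = 1) : IsTest (U * Λ * Uᴴ) :=
  ⟨h.1.mul_mul_conjTranspose_same U, by
    have := h.2.mul_mul_conjTranspose_same U
    rwa [mul_sub, sub_mul, mul_one, hU] at this⟩

/-- Differential privacy is invariant under a unitary change of basis. -/
theorem IsDPPair.conj {ι : Type*} [Fintype ι] [DecidableEq ι] {ε δ : ℝ} {ρ σ U : Matrix ι ι ℂ}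
    (h : IsDPPair ε δ ρ σ) (hU : U * Uᴴ = 1) :
    IsDPPair ε δ (Uᴴ * ρ * U) (Uᴴ * σ * U) := by
  refine ⟨h.1.conj hU, h.2.1.conj hU, fun Λ hΛ => ?_⟩
  have key (τ : Matrix ι ι ℂ) : (Λ * (Uᴴ * τ * U)).trace = (U * Λ * Uᴴ * τ).trace := by
    rw [← mul_assoc, Matrix.trace_mul_comm]
    simp only [mul_assoc]
  rw [key, key]
  exact h.2.2 _ (hΛ.conj hU)

theorem mixFamily_conj {ι : Type*} [Fintype ι] (ρ σ U : Matrix ι ι ℂ) (θ : ℝ) :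
    mixFamily (Uᴴ * ρ * U) (Uᴴ * σ * U) θ = Uᴴ * mixFamily ρ σ θ * U := by
  simp [mixFamily, mul_add, add_mul]

theorem mixFamily_posSemidef {ι : Type*} [Fintype ι] {ρ σ : Matrix ι ι ℂ} {θ : ℝ}
    (hρ : ρ.PosSemidef) (hσ : σ.PosSemidef) (h0 : 0 ≤ θ) (h1 : θ ≤ 1) :
    (mixFamily ρ σ θ).PosSemidef :=
  (hρ.smul h0).add (hσ.smul (sub_nonneg.2 h1))

/-- For positive semidefinite `A`, `v* A v = 0` forces `A v = 0`; here `v` is a basis vector. -/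
theorem Matrix.PosSemidef.apply_eq_zero_of_diag {ι : Type*} [Fintype ι] [DecidableEq ι]
    {A : Matrix ι ι ℂ} (hA : A.PosSemidef) {i : ι} (h : A i i = 0) (j : ι) : A j i = 0 := by
  have h1 : A *ᵥ Pi.single i 1 = 0 := by
    rw [← hA.dotProduct_mulVec_zero_iff]
    simp [h]
  simpa using congrFun h1 j

/-- A Hermitian matrix is diagonalised by a unitary matrix. -/
theorem Matrix.IsHermitian.exists_unitary_diagonal {ι : Type*} [Fintype ι] [DecidableEq ι]
    {A : Matrix ι ι ℂ} (hA : A.IsHermitian) :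
    ∃ (U : Matrix ι ι ℂ) (d : ι → ℝ), U * Uᴴ = 1 ∧
      Uᴴ * A * U = Matrix.diagonal fun i => (d i : ℂ) := by
  refine ⟨hA.eigenvectorUnitary, hA.eigenvalues, ?_, ?_⟩
  · exact Unitary.coe_mul_star_self hA.eigenvectorUnitary
  · have := hA.conjStarAlgAut_star_eigenvectorUnitary
    rw [Unitary.conjStarAlgAut_star_apply] at this
    exact this

theorem isSLD_conj {ι : Type*} [Fintype ι] [DecidableEq ι] {ρ σ U L : Matrix ι ι ℂ} {θ : ℝ}
    (hU : U * Uᴴ = 1) (h : IsSLD (mixFamily ρ σ) θ L) :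
    IsSLD (mixFamily (Uᴴ * ρ * U) (Uᴴ * σ * U)) θ (Uᴴ * L * U) := by
  rw [isSLD_mixFamily_iff] at h ⊢
  refine ⟨Matrix.isHermitian_conjTranspose_mul_mul U h.1, ?_⟩
  have key (X Y : Matrix ι ι ℂ) : Uᴴ * X * U * (Uᴴ * Y * U) = Uᴴ * (X * Y) * U := by
    calc Uᴴ * X * U * (Uᴴ * Y * U) = Uᴴ * X * (U * Uᴴ) * Y * U := by simp only [mul_assoc]
      _ = _ := by rw [hU]; simp only [mul_assoc, one_mul]
  rw [mixFamily_conj, key, key, ← add_mul, ← mul_add, h.2]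
  simp [mul_sub, sub_mul]

/-! ### Existence and uniqueness of the SLD Fisher information -/

/-- A symmetric logarithmic derivative exists. -/
theorem exists_isSLD {ι : Type*} [Fintype ι] [DecidableEq ι] {ρ σ : Matrix ι ι ℂ} {θ : ℝ}
    (hρ : ρ.PosSemidef) (hσ : σ.PosSemidef) (h0 : 0 < θ) (h1 : θ < 1) :
    ∃ L, IsSLD (mixFamily ρ σ) θ L := by
  obtain ⟨U, d, hU, hd⟩ :=
    (mixFamily_posSemidef hρ hσ h0.le h1.le).isHermitian.exists_unitary_diagonal
  have hρ' := hρ.conjTranspose_mul_mul_same U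
  have hσ' := hσ.conjTranspose_mul_mul_same U
  rw [← mixFamily_conj] at hd
  have hback (X : Matrix ι ι ℂ) : Uᴴᴴ * (Uᴴ * X * U) * Uᴴ = X := by
    calc Uᴴᴴ * (Uᴴ * X * U) * Uᴴ = (U * Uᴴ) * X * (U * Uᴴ) := by
          simp only [mul_assoc, conjTranspose_conjTranspose]
      _ = X := by rw [hU, one_mul, mul_one]
  suffices ∃ L, IsSLD (mixFamily (Uᴴ * ρ * U) (Uᴴ * σ * U)) θ L by
    obtain ⟨L, hL⟩ := this
    have := isSLD_conj (U := Uᴴ) (by rw [conjTranspose_conjTranspose, mul_eq_one_comm.1 hU]) hL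
    rw [conjTranspose_conjTranspose] at this hback
    rw [hback, hback] at this
    exact ⟨_, this⟩
  generalize Uᴴ * ρ * U = R at *
  generalize Uᴴ * σ * U = S at *
  have hdiag (i : ι) : (θ : ℂ) * R i i + (1 - θ) * S i i = d i := by
    have := congrFun (congrFun hd i) i
    simpa [mixFamily, Complex.real_smul] using this
  have hd0 (i : ι) : 0 ≤ d i := by
    have := (mixFamily_posSemidef hρ' hσ' h0.le h1.le).diag_nonneg (i := i)
    rw [hd] at this
    simpa using this
  -- Both weights `θ` and `1 - θ` are strictly positive, so the kernel of the mixture lies in both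
  -- kernels.
  have hzero (i : ι) (hi : d i = 0) : R i i = 0 ∧ S i i = 0 := by
    have hR := hρ'.diag_nonneg (i := i)
    have hS := hσ'.diag_nonneg (i := i)
    have e := hdiag i
    rw [Complex.nonneg_iff] at hR hS
    have e1 := congrArg Complex.re e
    simp [hi] at e1
    have a1 := mul_nonneg h0.le hR.1
    have a2 := mul_nonneg (sub_nonneg.2 h1.le) hS.1
    have b1 : (R i i).re = 0 := by
      have : θ * (R i i).re = 0 := by linarith
      simpa [h0.ne'] using this
    have b2 : (S i i).re = 0 := by
      have : (1 - θ) * (S i i).re = 0 := by linarith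
      simpa [(sub_pos.2 h1).ne'] using this
    exact ⟨Complex.ext b1 hR.2.symm, Complex.ext b2 hS.2.symm⟩
  -- Entrywise solution in the eigenbasis of the mixture. Where `d i + d j = 0` the quotient is `0`
  -- by convention, and `R i j = S i j = 0` there.
  refine ⟨Matrix.of fun i j => 2 * (R i j - S i j) / ((d i : ℂ) + d j),
    isSLD_mixFamily_iff.2 ⟨?_, ?_⟩⟩
  · ext i j
    simp [hρ'.isHermitian.apply i j, hσ'.isHermitian.apply i j, add_comm]
  · rw [hd]
    ext i j
    simp only [Matrix.add_apply, Matrix.mul_diagonal, Matrix.diagonal_mul, Matrix.of_apply,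
      Matrix.smul_apply, Matrix.sub_apply, smul_eq_mul]
    by_cases hz : (d i : ℂ) + d j = 0
    · have hz' : d i + d j = 0 := by exact_mod_cast hz
      have hj : d j = 0 := by linarith [hd0 i, hd0 j]
      rw [hρ'.apply_eq_zero_of_diag (hzero j hj).1, hσ'.apply_eq_zero_of_diag (hzero j hj).2]
      simp
    · field_simp
      ring

/-- The right side is symmetric in `L` and `M`, which is what lets two SLDs be compared. -/
theorem trace_sq_mul_of_isSLD {ι : Type*} [Fintype ι] [DecidableEq ι] {ρ σ L : Matrix ι ι ℂ}
    {θ : ℝ} (h : IsSLD (mixFamily ρ σ) θ L) (M : Matrix ι ι ℂ) :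
    2 * (M * (ρ - σ)).trace = (M * L * mixFamily ρ σ θ).trace + (L * M * mixFamily ρ σ θ).trace := by
  have h2 := (isSLD_mixFamily_iff.1 h).2
  have h3 := congrArg (fun X => (M * X).trace) h2
  simp only [mul_add, Matrix.trace_add, Matrix.mul_smul, Matrix.trace_smul, smul_eq_mul] at h3
  rw [← h3, ← mul_assoc, ← mul_assoc, Matrix.trace_mul_cycle M _ L]

/-- The SLD Fisher information is unambiguous. -/
theorem HasSLDFisherInfo.unique {ι : Type*} [Fintype ι] [DecidableEq ι] {ρ σ : Matrix ι ι ℂ}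
    {θ J K : ℝ} (hJ : HasSLDFisherInfo (mixFamily ρ σ) θ J)
    (hK : HasSLDFisherInfo (mixFamily ρ σ) θ K) : J = K := by
  obtain ⟨L, hL, eJ⟩ := hJ
  obtain ⟨M, hM, eK⟩ := hK
  have a := trace_sq_mul_of_isSLD hL L
  have b := trace_sq_mul_of_isSLD hM M
  have c := trace_sq_mul_of_isSLD hL M
  have d := trace_sq_mul_of_isSLD hM L
  rw [← pow_two, eJ] at a
  rw [← pow_two, eK] at b
  -- `J = Tr L(ρ-σ)` and `K = Tr M(ρ-σ)`, and both are half the same symmetric cross term.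
  have : (J : ℂ) = K := by linear_combination (b - a + d - c) / 2
  exact_mod_cast this

theorem existsUnique_hasSLDFisherInfo {ι : Type*} [Fintype ι] [DecidableEq ι]
    {ρ σ : Matrix ι ι ℂ} {θ : ℝ}
    (hρ : ρ.PosSemidef) (hσ : σ.PosSemidef) (h0 : 0 < θ) (h1 : θ < 1) :
    ∃! J : ℝ, HasSLDFisherInfo (mixFamily ρ σ) θ J := by
  obtain ⟨L, hL⟩ := exists_isSLD hρ hσ h0 h1
  have hpos : (L ^ 2 * mixFamily ρ σ θ).trace = (Lᴴ * mixFamily ρ σ θ * L).trace := by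
    rw [hL.1, Matrix.trace_mul_cycle, pow_two]
  have hnn := ((mixFamily_posSemidef hρ hσ h0.le h1.le).conjTranspose_mul_mul_same L).trace_nonneg
  rw [← hpos, Complex.nonneg_iff] at hnn
  refine ⟨(L ^ 2 * mixFamily ρ σ θ).trace.re, ⟨L, hL, ?_⟩, fun K hK => hK.unique ⟨L, hL, ?_⟩⟩ <;>
  exact Complex.ext rfl hnn.2.symm

/-! ### The upper bound -/

/-- The classical Fisher information of a single outcome is bounded by a linear functional
plus multiples of the two hockey-stick excesses. -/
theorem fisher_term_le {E θ p q l : ℝ} (hE : 1 ≤ E) (h0 : 0 < θ) (h1 : θ < 1)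
    (hp : 0 ≤ p) (hq : 0 ≤ q) (hl : l * (θ * p + (1 - θ) * q) = p - q) :
    (E + (1 - E) ^ 2 * (θ * (1 - θ))) * (l ^ 2 * (θ * p + (1 - θ) * q)) ≤
      (E - 1) ^ 2 * (θ * p + (1 - θ) * q) + (E - 1) ^ 2 * (1 - 2 * θ) * (p - q) +
        E / θ * max (p - E * q) 0 + E / (1 - θ) * max (q - E * p) 0 := by
  have h1' : 0 < 1 - θ := sub_pos.2 h1
  have hE0 : 0 < E := by linarith
  have ht0 : 0 ≤ θ * p + (1 - θ) * q := by positivity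
  rcases ht0.eq_or_lt with ht | ht
  · rw [← ht] at hl ⊢
    have hpq : p = q := by linarith
    subst hpq
    have m1 := le_max_right (p - E * p) 0
    have : 0 ≤ E / θ * max (p - E * p) 0 := by positivity
    have : 0 ≤ E / (1 - θ) * max (p - E * p) 0 := by positivity
    simp
    linarith
  · set t := θ * p + (1 - θ) * q with htdef
    -- The remainder `(p - Eq)(Ep - q)/t` is positive only if one of the two excesses is.
    have hterm : (E + (1 - E) ^ 2 * (θ * (1 - θ))) * (l ^ 2 * t) =
        (E - 1) ^ 2 * t + (E - 1) ^ 2 * (1 - 2 * θ) * (p - q) +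
          (p - E * q) * (E * p - q) / t := by
      rw [eq_comm, ← sub_eq_zero]
      have hl' : l = (p - q) / t := by field_simp; linarith
      rw [hl']
      field_simp
      rw [htdef]
      ring
    have m1 : 0 ≤ E / θ * max (p - E * q) 0 := by positivity
    have m2 : 0 ≤ E / (1 - θ) * max (q - E * p) 0 := by positivity
    have hex : (p - E * q) * (E * p - q) / t ≤
        E / θ * max (p - E * q) 0 + E / (1 - θ) * max (q - E * p) 0 := by
      rcases le_or_gt (p - E * q) 0 with hx | hx
      · rcases le_or_gt (q - E * p) 0 with hy | hy
        · have : (p - E * q) * (E * p - q) / t ≤ 0 :=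
            div_nonpos_of_nonpos_of_nonneg (mul_nonpos_of_nonpos_of_nonneg hx (by linarith)) ht.le
          linarith
        · have : (p - E * q) * (E * p - q) / t ≤ E / (1 - θ) * (q - E * p) := by
            rw [div_mul_eq_mul_div, div_le_div_iff₀ ht h1']
            have : (E * q - p) * (1 - θ) ≤ E * t := by
              rw [htdef]
              nlinarith [mul_nonneg h1'.le hp, mul_nonneg (mul_nonneg h0.le hE0.le) hp]
            nlinarith [mul_le_mul_of_nonneg_left this hy.le]
          rw [max_eq_left hy.le]
          linarith
      · have : (p - E * q) * (E * p - q) / t ≤ E / θ * (p - E * q) := by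
          rw [div_mul_eq_mul_div, div_le_div_iff₀ ht h0]
          have : (E * p - q) * θ ≤ E * t := by
            rw [htdef]
            nlinarith [mul_nonneg h0.le hq, mul_nonneg (mul_nonneg h1'.le hE0.le) hq]
          nlinarith [mul_le_mul_of_nonneg_left this hx.le]
        rw [max_eq_left hx.le]
        linarith
    linarith

theorem isTest_diagonal {ι : Type*} [Fintype ι] [DecidableEq ι] (s : ι → Prop)
    [DecidablePred s] : IsTest (Matrix.diagonal fun i => if s i then (1 : ℂ) else 0) := by
  constructor
  · refine Matrix.PosSemidef.diagonal fun i => ?_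
    dsimp only [Pi.zero_apply]
    split_ifs <;> simp
  · rw [← Matrix.diagonal_one, Matrix.diagonal_sub]
    refine Matrix.PosSemidef.diagonal fun i => ?_
    dsimp only [Pi.zero_apply]
    split_ifs <;> simp

theorem trace_diagonal_ite_mul {ι : Type*} [Fintype ι] [DecidableEq ι] (s : ι → Prop)
    [DecidablePred s] (ρ : Matrix ι ι ℂ) :
    (Matrix.diagonal (fun i => if s i then (1 : ℂ) else 0) * ρ).trace.re =
      ∑ i, if s i then (ρ i i).re else 0 := by
  simp only [Matrix.trace, Matrix.diag_apply, Matrix.diagonal_mul, Complex.re_sum]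
  refine Finset.sum_congr rfl fun i _ => ?_
  split_ifs <;> simp

theorem IsDPPair.swap {ι : Type*} [Fintype ι] [DecidableEq ι] {ε δ : ℝ} {ρ σ : Matrix ι ι ℂ}
    (h : IsDPPair ε δ ρ σ) : IsDPPair ε δ σ ρ :=
  ⟨h.2.1, h.1, fun Λ hΛ => (h.2.2 Λ hΛ).symm⟩

/-- The diagonals of a differentially private pair have hockey-stick divergence at most `δ`. -/
theorem IsDPPair.sum_max_le {ι : Type*} [Fintype ι] [DecidableEq ι] {ε δ : ℝ}
    {ρ σ : Matrix ι ι ℂ} (h : IsDPPair ε δ ρ σ) :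
    ∑ i, max ((ρ i i).re - Real.exp ε * (σ i i).re) 0 ≤ δ := by
  classical
  -- The likelihood-ratio test collects exactly the positive parts.
  have := (h.2.2 _ (isTest_diagonal fun i => 0 ≤ (ρ i i).re - Real.exp ε * (σ i i).re)).1
  rw [trace_diagonal_ite_mul, trace_diagonal_ite_mul, Finset.mul_sum, ← sub_le_iff_le_add',
    ← Finset.sum_sub_distrib] at this
  refine le_trans (le_of_eq (Finset.sum_congr rfl fun i _ => ?_)) this
  split_ifs with hi
  · exact max_eq_left hi
  · simpa using (not_le.1 hi).le

theorem IsDensityMatrix.sum_re {ι : Type*} [Fintype ι] {ρ : Matrix ι ι ℂ}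
    (h : IsDensityMatrix ρ) : ∑ i, (ρ i i).re = 1 := by
  simpa [Matrix.trace] using congrArg Complex.re h.2

theorem maxFisher_eq {ε δ θ : ℝ} (h0 : 0 < θ) (h1 : θ < 1) :
    (Real.exp ε + (1 - Real.exp ε) ^ 2 * (θ * (1 - θ))) * maxFisher ε δ θ =
      (Real.exp ε - 1) ^ 2 + Real.exp ε / θ * δ + Real.exp ε / (1 - θ) * δ := by
  have h1' : 0 < 1 - θ := sub_pos.2 h1
  have hD : 0 < Real.exp ε + (1 - Real.exp ε) ^ 2 * (θ * (1 - θ)) := by positivity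
  unfold maxFisher
  rw [mul_add, mul_div_cancel₀ _ hD.ne']
  generalize Real.exp ε = E at *
  field_simp
  ring

/-- The SLD Fisher information of a differentially private pair is at most `maxFisher`. -/
theorem HasSLDFisherInfo.le_maxFisher {ι : Type*} [Fintype ι] [DecidableEq ι] {ε δ θ J : ℝ}
    {ρ σ : Matrix ι ι ℂ} (hε : 0 ≤ ε) (h0 : 0 < θ) (h1 : θ < 1) (h : IsDPPair ε δ ρ σ)
    (hJ : HasSLDFisherInfo (mixFamily ρ σ) θ J) : J ≤ maxFisher ε δ θ := by
  obtain ⟨L, hL, eJ⟩ := hJ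
  obtain ⟨U, d, hU, hd⟩ := hL.1.exists_unitary_diagonal
  have hdp := h.conj hU
  have hsld := isSLD_conj hU hL
  have hJ' : ((Uᴴ * L * U) ^ 2 * mixFamily (Uᴴ * ρ * U) (Uᴴ * σ * U) θ).trace = J := by
    rw [mixFamily_conj, ← eJ]
    calc ((Uᴴ * L * U) ^ 2 * (Uᴴ * mixFamily ρ σ θ * U)).trace
        = (Uᴴ * L * (U * Uᴴ) * L * (U * Uᴴ) * mixFamily ρ σ θ * U).trace := by
          simp only [pow_two, mul_assoc]
      _ = (U * Uᴴ * (L * L * mixFamily ρ σ θ)).trace := by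
          rw [hU, mul_one, mul_one, Matrix.trace_mul_comm]
          simp only [← mul_assoc, hU]
      _ = _ := by rw [hU, one_mul, pow_two]
  rw [hd] at hsld hJ'
  generalize Uᴴ * ρ * U = R at *
  generalize Uᴴ * σ * U = S at *
  have hmix (i : ι) : (mixFamily R S θ i i).re = θ * (R i i).re + (1 - θ) * (S i i).re := by
    simp [mixFamily]
  have hJsum : J = ∑ i, d i ^ 2 * (θ * (R i i).re + (1 - θ) * (S i i).re) := by
    have := congrArg Complex.re hJ'
    rw [Matrix.diagonal_pow] at this
    simp only [Matrix.trace, Matrix.diag_apply, Matrix.diagonal_mul, Complex.re_sum,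
      Pi.pow_apply, ← Complex.ofReal_pow, Complex.re_ofReal_mul, hmix, Complex.ofReal_re] at this
    exact this.symm
  have hl (i : ι) : d i * (θ * (R i i).re + (1 - θ) * (S i i).re) = (R i i).re - (S i i).re := by
    have := congrArg Complex.re (congrFun (congrFun (isSLD_mixFamily_iff.1 hsld).2 i) i)
    simp only [Matrix.add_apply, Matrix.mul_diagonal, Matrix.diagonal_mul, Matrix.smul_apply,
      Matrix.sub_apply, smul_eq_mul, Complex.add_re, Complex.re_ofReal_mul,
      Complex.re_mul_ofReal, hmix] at this
    simp at this
    linarith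
  have hD : 0 < Real.exp ε + (1 - Real.exp ε) ^ 2 * (θ * (1 - θ)) := by
    have := sub_pos.2 h1
    positivity
  refine le_of_mul_le_mul_left ?_ hD
  rw [maxFisher_eq h0 h1, hJsum, Finset.mul_sum]
  refine (Finset.sum_le_sum fun i _ => fisher_term_le (Real.one_le_exp hε) h0 h1
    (Complex.nonneg_iff.1 hdp.1.1.diag_nonneg).1
    (Complex.nonneg_iff.1 hdp.2.1.1.diag_nonneg).1 (hl i)).trans ?_
  simp only [Finset.sum_add_distrib, ← Finset.mul_sum, Finset.sum_sub_distrib]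
  -- Unit traces make the `(1 - 2θ)(p - q)` terms sum to zero.
  rw [hdp.1.sum_re, hdp.2.1.sum_re]
  have h1' : 0 < 1 - θ := sub_pos.2 h1
  have b1 := mul_le_mul_of_nonneg_left hdp.sum_max_le
    (show 0 ≤ Real.exp ε / θ by positivity)
  have b2 := mul_le_mul_of_nonneg_left hdp.swap.sum_max_le
    (show 0 ≤ Real.exp ε / (1 - θ) by positivity)
  linarith

/-! ### The extremal pair -/

/-- The outcome distribution of `weakestRho`. -/
noncomputable def weakestP (ε δ : ℝ) : Fin 2 × Fin 2 → ℝ := fun x =>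
  !![δ, (1 - δ) * (Real.exp ε / (1 + Real.exp ε));
    (1 - δ) * (1 / (1 + Real.exp ε)), 0] x.1 x.2

/-- The outcome distribution of `weakestSigma`. -/
noncomputable def weakestQ (ε δ : ℝ) : Fin 2 × Fin 2 → ℝ := fun x =>
  !![0, (1 - δ) * (1 / (1 + Real.exp ε));
    (1 - δ) * (Real.exp ε / (1 + Real.exp ε)), δ] x.1 x.2

theorem weakestRho_eq (ε δ : ℝ) :
    weakestRho ε δ = Matrix.diagonal fun x => (weakestP ε δ x : ℂ) := by
  ext ⟨i, j⟩ ⟨k, l⟩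
  fin_cases i <;> fin_cases j <;> fin_cases k <;> fin_cases l <;>
    simp [weakestRho, weakestP]

theorem weakestSigma_eq (ε δ : ℝ) :
    weakestSigma ε δ = Matrix.diagonal fun x => (weakestQ ε δ x : ℂ) := by
  ext ⟨i, j⟩ ⟨k, l⟩
  fin_cases i <;> fin_cases j <;> fin_cases k <;> fin_cases l <;>
    simp [weakestSigma, weakestQ]

theorem isDensityMatrix_diagonal {ι : Type*} [Fintype ι] [DecidableEq ι] {p : ι → ℝ}
    (hp : ∀ i, 0 ≤ p i) (h : ∑ i, p i = 1) :
    IsDensityMatrix (Matrix.diagonal fun i => (p i : ℂ)) :=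
  ⟨Matrix.PosSemidef.diagonal fun i => by simpa using hp i, by
    rw [Matrix.trace_diagonal]; exact_mod_cast h⟩

theorem trace_mul_diagonal_re {ι : Type*} [Fintype ι] [DecidableEq ι] (Λ : Matrix ι ι ℂ)
    (p : ι → ℝ) :
    (Λ * Matrix.diagonal fun i => (p i : ℂ)).trace.re = ∑ i, (Λ i i).re * p i := by
  simp [Matrix.trace, Matrix.mul_diagonal]

theorem isDPPair_weakest {ε δ : ℝ} (hε : 0 ≤ ε) (hδ0 : 0 ≤ δ) (hδ1 : δ ≤ 1) :
    IsDPPair ε δ (weakestRho ε δ) (weakestSigma ε δ) := by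
  have hE : 1 ≤ Real.exp ε := Real.one_le_exp hε
  have hδ : 0 ≤ 1 - δ := sub_nonneg.2 hδ1
  have hP (x) : 0 ≤ weakestP ε δ x := by
    obtain ⟨i, j⟩ := x
    fin_cases i <;> fin_cases j <;> simp [weakestP] <;> positivity
  have hQ (x) : 0 ≤ weakestQ ε δ x := by
    obtain ⟨i, j⟩ := x
    fin_cases i <;> fin_cases j <;> simp [weakestQ] <;> positivity
  rw [weakestRho_eq, weakestSigma_eq]
  refine ⟨isDensityMatrix_diagonal hP ?_, isDensityMatrix_diagonal hQ ?_, fun Λ hΛ => ?_⟩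
  · simp [Fintype.sum_prod_type, weakestP]
    field_simp
    ring
  · simp [Fintype.sum_prod_type, weakestQ]
    field_simp
    ring
  · have hl (x) : 0 ≤ (Λ x x).re := (Complex.nonneg_iff.1 hΛ.1.diag_nonneg).1
    have hu (x) : (Λ x x).re ≤ 1 := by
      have := (Complex.nonneg_iff.1 (hΛ.2.diag_nonneg (i := x))).1
      simpa using this
    have hr : 1 / (1 + Real.exp ε) ≤ Real.exp ε * (Real.exp ε / (1 + Real.exp ε)) := by
      rw [← mul_div_assoc]
      gcongr
      nlinarith
    have hr' : Real.exp ε / (1 + Real.exp ε) = Real.exp ε * (1 / (1 + Real.exp ε)) := by ring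
    rw [trace_mul_diagonal_re, trace_mul_diagonal_re]
    simp only [Fintype.sum_prod_type, Fin.sum_univ_two]
    simp only [weakestP, weakestQ, Matrix.of_apply, Matrix.cons_val', Matrix.cons_val_zero,
      Matrix.cons_val_one, Matrix.cons_val_fin_one, mul_zero, add_zero, zero_add]
    have a1 := mul_le_mul_of_nonneg_left hr (mul_nonneg (hl (1, 0)) hδ)
    have a2 := mul_le_mul_of_nonneg_left hr (mul_nonneg (hl (0, 1)) hδ)
    have a3 := mul_nonneg (Real.exp_pos ε).le (mul_nonneg (hl (0, 0)) hδ0)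
    have a4 := mul_nonneg (Real.exp_pos ε).le (mul_nonneg (hl (1, 1)) hδ0)
    have a5 := mul_le_mul_of_nonneg_right (hu (0, 0)) hδ0
    have a6 := mul_le_mul_of_nonneg_right (hu (1, 1)) hδ0
    generalize 1 / (1 + Real.exp ε) = r at *
    generalize Real.exp ε / (1 + Real.exp ε) = s at *
    subst hr'
    constructor <;> linarith

/-- The eigenvalues of the symmetric logarithmic derivative of the weakest pair. -/
noncomputable def weakestScore (ε θ : ℝ) : Fin 2 × Fin 2 → ℝ := fun x =>
  !![1 / θ, (Real.exp ε - 1) / (θ * Real.exp ε + (1 - θ));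
    -(Real.exp ε - 1) / (θ + (1 - θ) * Real.exp ε), -1 / (1 - θ)] x.1 x.2

theorem mixFamily_diagonal {ι : Type*} [DecidableEq ι] (p q : ι → ℝ) (θ : ℝ) :
    mixFamily (Matrix.diagonal fun i => (p i : ℂ)) (Matrix.diagonal fun i => (q i : ℂ)) θ =
      Matrix.diagonal fun i => ((θ * p i + (1 - θ) * q i : ℝ) : ℂ) := by
  ext i j
  by_cases hij : i = j <;> simp [mixFamily, hij]

/-- The SLD Fisher information of commuting states is the classical one. -/
theorem hasSLDFisherInfo_diagonal {ι : Type*} [Fintype ι] [DecidableEq ι] {p q l : ι → ℝ}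
    {θ : ℝ} (h : ∀ i, l i * (θ * p i + (1 - θ) * q i) = p i - q i) :
    HasSLDFisherInfo
      (mixFamily (Matrix.diagonal fun i => (p i : ℂ)) (Matrix.diagonal fun i => (q i : ℂ))) θ
      (∑ i, l i * (p i - q i)) := by
  refine ⟨Matrix.diagonal fun i => (l i : ℂ), isSLD_mixFamily_iff.2 ⟨?_, ?_⟩, ?_⟩
  · refine Matrix.isHermitian_diagonal_of_self_adjoint _ (funext fun i => ?_)
    simp
  · rw [mixFamily_diagonal, Matrix.diagonal_mul_diagonal, Matrix.diagonal_mul_diagonal,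
      Matrix.diagonal_add, Matrix.diagonal_sub, ← Matrix.diagonal_smul]
    congr 1
    funext i
    have : (l i : ℂ) * ((θ * p i + (1 - θ) * q i : ℝ) : ℂ) = p i - q i := by
      exact_mod_cast h i
    simp only [Pi.smul_apply, smul_eq_mul]
    linear_combination 2 * this
  · rw [mixFamily_diagonal, Matrix.diagonal_pow, Matrix.diagonal_mul_diagonal,
      Matrix.trace_diagonal]
    push_cast
    refine Finset.sum_congr rfl fun i _ => ?_
    have : (l i : ℂ) * (θ * p i + (1 - θ) * q i) = p i - q i := by
      exact_mod_cast h i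
    simp only [Pi.pow_apply]
    linear_combination (l i : ℂ) * this

theorem hasSLDFisherInfo_weakest (ε δ : ℝ) {θ : ℝ} (h0 : 0 < θ) (h1 : θ < 1) :
    HasSLDFisherInfo (mixFamily (weakestRho ε δ) (weakestSigma ε δ)) θ (maxFisher ε δ θ) := by
  have h1' : 0 < 1 - θ := sub_pos.2 h1
  have hE := Real.exp_pos ε
  have hA : 0 < θ * Real.exp ε + (1 - θ) := by positivity
  have hB : 0 < θ + (1 - θ) * Real.exp ε := by positivity
  -- The factors are the score denominators at `01` and `10`; they add up to `1 + e^ε`, which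
  -- cancels the normalisation when the two contributions are combined.
  have hAB : Real.exp ε + (1 - Real.exp ε) ^ 2 * (θ * (1 - θ)) =
      (θ * Real.exp ε + (1 - θ)) * (θ + (1 - θ) * Real.exp ε) := by ring
  have hsum : maxFisher ε δ θ =
      ∑ x, weakestScore ε θ x * (weakestP ε δ x - weakestQ ε δ x) := by
    simp only [Fintype.sum_prod_type, Fin.sum_univ_two]
    simp only [weakestScore, weakestP, weakestQ, Matrix.of_apply, Matrix.cons_val',
      Matrix.cons_val_zero, Matrix.cons_val_one, Matrix.cons_val_fin_one, maxFisher]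
    rw [hAB]
    generalize Real.exp ε = E at *
    field_simp
    ring
  rw [hsum, weakestRho_eq, weakestSigma_eq]
  refine hasSLDFisherInfo_diagonal ?_
  rintro ⟨i, j⟩
  fin_cases i <;> fin_cases j <;> simp [weakestScore, weakestP, weakestQ] <;> field_simp

theorem mainTheorem4 (ε δ : ℝ) (hε : 0 ≤ ε) (hδ0 : 0 ≤ δ) (hδ1 : δ ≤ 1) :
    -- the weakest pair is an `(ε, δ)`-DP pair (and does not depend on `θ`)
    IsDPPair ε δ (weakestRho ε δ) (weakestSigma ε δ) ∧
    ∀ θ : ℝ, 0 < θ → θ < 1 →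
      -- the SLD Fisher information of every `(ε, δ)`-DP pair exists and is unambiguous
      (∀ (ι : Type) [Fintype ι] [DecidableEq ι] (ρ σ : Matrix ι ι ℂ), IsDPPair ε δ ρ σ →
        ∃! J : ℝ, HasSLDFisherInfo (mixFamily ρ σ) θ J) ∧
      -- its maximum over all pairs, in all finite dimensions
      IsGreatest
        {J : ℝ | ∃ (ι : Type) (_ : Fintype ι) (_ : DecidableEq ι) (ρ σ : Matrix ι ι ℂ),
          IsDPPair ε δ ρ σ ∧ HasSLDFisherInfo (mixFamily ρ σ) θ J}
        (maxFisher ε δ θ) ∧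
      -- the weakest pair attains it
      HasSLDFisherInfo (mixFamily (weakestRho ε δ) (weakestSigma ε δ)) θ (maxFisher ε δ θ) := by
  have hdp := isDPPair_weakest hε hδ0 hδ1
  refine ⟨hdp, fun θ h0 h1 => ⟨fun ι _ _ ρ σ h => ?_, ⟨?_, ?_⟩, hasSLDFisherInfo_weakest ε δ h0 h1⟩⟩
  · exact existsUnique_hasSLDFisherInfo h.1.1 h.2.1.1 h0 h1
  · exact ⟨_, inferInstance, inferInstance, _, _, hdp, hasSLDFisherInfo_weakest ε δ h0 h1⟩
  · rintro J ⟨ι, _, _, ρ, σ, h, hJ⟩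
    exact hJ.le_maxFisher hε h0 h1 h
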